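/- Let $\mu$ be a finite Borel measure on $\mathbb{C}$ whose support is compact and infinite. Let $\Phi_n$ ($n\ge 0$) be its monic orthogonal polynomials (Gram–Schmidt applied to $1,z,z^2,\dots$ in $L^2(\mu)$), let $\kappa_n=\|\Phi_n\|_{L^2(\mu)}^{-1}$, let $\varphi_n=\kappa_n\Phi_n$ be the orthonormal polynomials, and let $M=(M_{j,k})_{j,k\ge 1}$ be the matrix of the Bergman shift (multiplication by $z$) in the basis $(\varphi_n)$, that is $M_{j,k}=\int z\,\varphi_{k-1}(z)\overline{\varphi_{j-1}(z)}\,d\mu(z)$. The following are equivalent. (a) There are $R>0$ and a function $f$ analytic in $\{z: R<|z|\le\infty\}$ (a subset of the Riemann sphere) such that $$\lim_{n\to\infty}\frac{\Phi_n(z)}{\Phi_{n+1}(z)}=f(z)\qquad\text{for every } z \text{ with } R<|z|\le\infty,$$ where for each finite such $z$ it is understood that $\Phi_{n+1}(z)\neq 0$ for all large $n$, and where $\Phi_n/\Phi_{n+1}$ has the value $0$ at $\infty$. (b) For every integer $j\ge 0$ the limit $$\lim_{n\to\infty}\frac{\kappa_{n-1-j}}{\kappa_{n-1}}\,M_{n-j,n}$$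 exists in $\mathbb{C}$. If either condition holds, then for every integer $j\ge 0$ the limit $$\lim_{n\to\infty}\int z^j|\varphi_n(z)|^2\,d\mu(z)$$ exists in $\mathbb{C}$, and it is determined by the limits in (a) or (b): if $\nu$ is another finite Borel measure on $\mathbb{C}$ with compact infinite support, and either (a) holds for $\mu$ and $\nu$ with the same $R$ and $f$, or for every $j\ge 0$ the limit in (b) exists for both measures and has the same value, then $\int z^j|\varphi_n(z;\nu)|^2\,d\nu(z)$ converges to the same limit as for $\mu$, for every $j\ge 0$. -/

import Mathlib

open MeasureTheory Filter Topology Polynomial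

noncomputable section

namespace BergmanShift

/-- The inner product `⟨p, q⟩ = ∫ p(z) * conj (q(z)) dμ(z)` of two polynomials in `L²(ℂ, μ)`. -/
def polyInner (μ : Measure ℂ) (p q : ℂ[X]) : ℂ :=
  ∫ z, p.eval z * (starRingEnd ℂ) (q.eval z) ∂μ

/-- The monic orthogonal polynomials `Φ_n` of `μ`: Gram-Schmidt orthogonalization (without
normalization) of `1, z, z², …` in `L²(ℂ, μ)`. -/
def monicOP (μ : Measure ℂ) (n : ℕ) : ℂ[X] :=
  X ^ n - ∑ k : Fin n,
    C (polyInner μ (X ^ n) (monicOP μ k) / polyInner μ (monicOP μ k) (monicOP μ k)) * monicOP μ k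
termination_by n
decreasing_by all_goals exact k.isLt

/-- The leading coefficient `κ_n = 1 / ‖Φ_n‖_{L²(μ)}` of the `n`-th orthonormal polynomial. -/
def kappa (μ : Measure ℂ) (n : ℕ) : ℝ :=
  (Real.sqrt (∫ z, ‖(monicOP μ n).eval z‖ ^ 2 ∂μ))⁻¹

/-- The orthonormal polynomials `φ_n = κ_n Φ_n` of `μ`. -/
def orthonormalPoly (μ : Measure ℂ) (n : ℕ) : ℂ[X] :=
  C (kappa μ n : ℂ) * monicOP μ n

/-- The matrix of the Bergman shift `f ↦ z f` in the basis `φ_0, φ_1, …`.  Rows and columns are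
numbered from `0`: `bergmanMatrix μ j k = ⟨z φ_k, φ_j⟩` is the entry that is called `M_{j+1,k+1}`
when rows and columns are numbered from `1`. -/
def bergmanMatrix (μ : Measure ℂ) : Matrix ℕ ℕ ℂ :=
  Matrix.of fun j k => polyInner μ (X * orthonormalPoly μ k) (orthonormalPoly μ j)

/-- The moment `∫ z^j |φ_n(z)|² dμ(z)`. -/
def moment (μ : Measure ℂ) (j n : ℕ) : ℂ :=
  ∫ z, z ^ j * ((‖(orthonormalPoly μ n).eval z‖ ^ 2 : ℝ) : ℂ) ∂μ

/-- The values of the rational function `p / q` on the Riemann sphere, for `deg p ≤ deg q`, away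
from the zeros of `q`; the value at infinity is the quotient of the coefficients of
`z ^ deg q` (see `tendsto_ratioSphere`). -/
def ratioSphere (p q : ℂ[X]) : OnePoint ℂ → ℂ
  | OnePoint.infty => p.coeff q.natDegree / q.leadingCoeff
  | OnePoint.some z => p.eval z / q.eval z

/-- The value at infinity in `ratioSphere` is the limit of the finite values. -/
theorem tendsto_ratioSphere {p q : ℂ[X]} (h : p.degree < q.degree) :
    Tendsto (fun z : ℂ => ratioSphere p q z) (cocompact ℂ) (𝓝 (ratioSphere p q OnePoint.infty)) := by
  have h1 : ratioSphere p q OnePoint.infty = 0 := by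
    simp [ratioSphere, coeff_eq_zero_of_degree_lt (h.trans_le degree_le_natDegree)]
  rw [h1, ← Metric.cobounded_eq_cocompact]
  exact (isLittleO_cobounded_of_degree_lt h).tendsto_div_nhds_zero

/-- The local coordinate `w = 1 / z` of the Riemann sphere at infinity: `w ↦ 1 / w`, `0 ↦ ∞`. -/
def sphereInv (w : ℂ) : OnePoint ℂ :=
  if w = 0 then OnePoint.infty else OnePoint.some w⁻¹

/-- `f` is analytic in `{z : R < |z| ≤ ∞}`. -/
def AnalyticOutside (R : ℝ) (f : OnePoint ℂ → ℂ) : Prop :=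
  AnalyticOnNhd ℂ (fun z : ℂ => f (OnePoint.some z)) {z : ℂ | R < ‖z‖} ∧
    AnalyticAt ℂ (fun w : ℂ => f (sphereInv w)) 0

/-- `f` is analytic in `{z : R < |z| ≤ ∞}` and `Φ_n(z) / Φ_{n+1}(z) → f(z)` at every point of this
set.  At a finite point the quotient has to be defined for all large `n`. -/
def HasRatioLimit (μ : Measure ℂ) (R : ℝ) (f : OnePoint ℂ → ℂ) : Prop :=
  AnalyticOutside R f ∧
    (∀ z : ℂ, R < ‖z‖ →
      (∀ᶠ n in atTop, (monicOP μ (n + 1)).eval z ≠ 0) ∧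
      Tendsto (fun n => ratioSphere (monicOP μ n) (monicOP μ (n + 1)) (OnePoint.some z)) atTop
        (𝓝 (f (OnePoint.some z)))) ∧
    Tendsto (fun n => ratioSphere (monicOP μ n) (monicOP μ (n + 1)) OnePoint.infty) atTop
      (𝓝 (f OnePoint.infty))

/-- `(κ_{n-1-j} / κ_{n-1}) M_{n-j,n} → c` as `n → ∞`, where `M` is numbered from `1`; here
`n - 1 - j` is called `m`. -/
def HasDiagonalLimit (μ : Measure ℂ) (j : ℕ) (c : ℂ) : Prop :=
  Tendsto (fun m : ℕ => ((kappa μ m / kappa μ (m + j) : ℝ) : ℂ) * bergmanMatrix μ m (m + j)) atTop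
    (𝓝 c)

end BergmanShift

end

noncomputable section

namespace BergmanShift

/-! Write `z Φ_n = Φ_{n+1} + ∑ a_{n,i} Φ_{n-i}`. The normalizing factors in (b) turn the matrix
entry into exactly `a_{m+j,j}` (`hasDiagonalLimit_iff`), so (b) says that each sequence `n ↦
a_{n,j}` converges.

Compress multiplication by `z` to the polynomials of degree at most `n`, and call this operator
`T_n`. Iterating it gives `Φ_n / Φ_{n+1} = ∑ b_{n,k} z^{-k-1}`, where `b_{n,k}` is the
`Φ_n`-component of `T_n^k Φ_n` (`hasSum_ratioCoeff`). A compression does not increase norms, so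
`|b_{n,k}| ≤ R^k` uniformly in `n` if the support lies in the disk of radius `R`
(`norm_ratioCoeff_le`). With this bound, pointwise convergence of the ratios near infinity amounts
to convergence of every `b_{n,k}`: one direction is `tendsto_coeff_zero_of_tendsto_tsum`, the other
dominated convergence.

Each `b_{n,k}` is a sum over paths weighted by the `a`'s, and `b_{n,k+1}` equals `a_{n,k}` plus
terms whose weights drop by less than `k` (`truncPathSum_succ_zero`). This triangular system
transfers convergence both ways and lets the limits determine each other. The moment is the
`Φ_n`-component of `z^j Φ_n`, again a finite path sum (`moment_eq_pathSum`), so its limit depends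
only on the limits of the `a`'s. -/

/-! ### The inner product on polynomials -/

theorem integrable_of_continuous {μ : Measure ℂ} [IsFiniteMeasure μ] (hc : IsCompact μ.support)
    {f : ℂ → ℂ} (hf : Continuous f) : Integrable f μ := by
  have h := hf.continuousOn.integrableOn_compact (μ := μ) hc
  have hs : ∀ᵐ z ∂μ, z ∈ μ.support := Measure.support_mem_ae
  rwa [IntegrableOn, Measure.restrict_eq_self_of_ae_mem hs] at h

theorem continuous_mul_conj_eval (p q : ℂ[X]) :
    Continuous fun z : ℂ => p.eval z * (starRingEnd ℂ) (q.eval z) :=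
  p.continuous.mul (Complex.continuous_conj.comp q.continuous)

/-- `⟨p, q⟩` as a linear functional of `p`. -/
def polyInnerLeft (μ : Measure ℂ) [IsFiniteMeasure μ] (hc : IsCompact μ.support) (q : ℂ[X]) :
    ℂ[X] →ₗ[ℂ] ℂ where
  toFun p := polyInner μ p q
  map_add' p p' := by
    simp only [polyInner, eval_add, add_mul]
    exact integral_add (integrable_of_continuous hc (continuous_mul_conj_eval p q))
      (integrable_of_continuous hc (continuous_mul_conj_eval p' q))
  map_smul' c p := by
    simp only [polyInner, eval_smul, smul_eq_mul, mul_assoc, RingHom.id_apply]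
    exact integral_const_mul _ _

theorem conj_polyInner (μ : Measure ℂ) (p q : ℂ[X]) :
    (starRingEnd ℂ) (polyInner μ p q) = polyInner μ q p := by
  simp only [polyInner, ← integral_conj, map_mul, Complex.conj_conj, mul_comm]

theorem polyInner_C_mul_left (μ : Measure ℂ) (c : ℂ) (p q : ℂ[X]) :
    polyInner μ (C c * p) q = c * polyInner μ p q := by
  simp only [polyInner, eval_mul, eval_C, mul_assoc]
  exact integral_const_mul _ _

theorem polyInner_C_mul_right (μ : Measure ℂ) (c : ℂ) (p q : ℂ[X]) :
    polyInner μ p (C c * q) = (starRingEnd ℂ) c * polyInner μ p q := by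
  rw [← conj_polyInner, polyInner_C_mul_left, map_mul, conj_polyInner]

/-- The square of the norm of a polynomial in `L²(μ)`. -/
def polyNormSq (μ : Measure ℂ) (p : ℂ[X]) : ℝ := ∫ z, ‖p.eval z‖ ^ 2 ∂μ

theorem polyInner_self (μ : Measure ℂ) (p : ℂ[X]) : polyInner μ p p = (polyNormSq μ p : ℂ) := by
  simp only [polyInner, polyNormSq, Complex.mul_conj']
  rw [← integral_complex_ofReal]
  simp

theorem polyNormSq_nonneg (μ : Measure ℂ) (p : ℂ[X]) : 0 ≤ polyNormSq μ p :=
  integral_nonneg fun _ => by positivity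

theorem polyNormSq_C_mul (μ : Measure ℂ) (c : ℂ) (p : ℂ[X]) :
    polyNormSq μ (C c * p) = ‖c‖ ^ 2 * polyNormSq μ p := by
  simp only [polyNormSq, eval_mul, eval_C, norm_mul, mul_pow]
  exact integral_const_mul _ _

section FiniteMeasure

variable {μ : Measure ℂ} [IsFiniteMeasure μ]

theorem integrable_normSq_eval (hc : IsCompact μ.support) (p : ℂ[X]) :
    Integrable (fun z => ‖p.eval z‖ ^ 2) μ := by
  have h := (integrable_of_continuous hc (continuous_mul_conj_eval p p)).norm
  refine h.congr (Eventually.of_forall fun z => ?_)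
  simp [pow_two]

theorem polyInner_add_left (hc : IsCompact μ.support) (p p' q : ℂ[X]) :
    polyInner μ (p + p') q = polyInner μ p q + polyInner μ p' q :=
  map_add (polyInnerLeft μ hc q) p p'

theorem polyInner_sub_left (hc : IsCompact μ.support) (p p' q : ℂ[X]) :
    polyInner μ (p - p') q = polyInner μ p q - polyInner μ p' q :=
  map_sub (polyInnerLeft μ hc q) p p'

theorem polyInner_sum_left (hc : IsCompact μ.support) {ι : Type*} (s : Finset ι) (p : ι → ℂ[X])
    (q : ℂ[X]) : polyInner μ (∑ i ∈ s, p i) q = ∑ i ∈ s, polyInner μ (p i) q :=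
  map_sum (polyInnerLeft μ hc q) p s

theorem polyInner_add_right (hc : IsCompact μ.support) (p q q' : ℂ[X]) :
    polyInner μ p (q + q') = polyInner μ p q + polyInner μ p q' := by
  rw [← conj_polyInner, polyInner_add_left hc, map_add, conj_polyInner, conj_polyInner]

theorem polyNormSq_add_of_orthogonal (hc : IsCompact μ.support) {p q : ℂ[X]}
    (h : polyInner μ p q = 0) : polyNormSq μ (p + q) = polyNormSq μ p + polyNormSq μ q := by
  have h' : polyInner μ q p = 0 := by rw [← conj_polyInner, h, map_zero]
  have : (polyNormSq μ (p + q) : ℂ) = polyNormSq μ p + polyNormSq μ q := by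
    rw [← polyInner_self, polyInner_add_left hc, polyInner_add_right hc, polyInner_add_right hc, h,
      h', polyInner_self, polyInner_self]
    ring
  exact_mod_cast this

/-- If the norm vanished, the closed zero set of `p` would have full measure and so contain the
infinite support. All later uses of the infinite support go back to this. -/
theorem polyNormSq_pos (hc : IsCompact μ.support) (hi : μ.support.Infinite) {p : ℂ[X]}
    (hp : p ≠ 0) : 0 < polyNormSq μ p := by
  refine lt_of_le_of_ne (polyNormSq_nonneg μ p) fun h0 => hi ?_
  have h1 : (fun z => ‖p.eval z‖ ^ 2) =ᵐ[μ] 0 :=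
    (integral_eq_zero_iff_of_nonneg (fun _ => by positivity) (integrable_normSq_eval hc p)).1 h0.symm
  have h2 : {z : ℂ | p.eval z = 0} ∈ ae μ := by
    filter_upwards [h1] with z hz
    simpa using hz
  have hcl : IsClosed {z : ℂ | p.eval z = 0} := isClosed_eq p.continuous continuous_const
  refine Set.Finite.subset ?_ (Measure.support_subset_of_isClosed hcl h2)
  exact p.rootSet_finite ℂ |>.subset fun z hz => by
    rw [mem_rootSet]; exact ⟨hp, by simpa [aeval_def] using hz⟩

theorem polyNormSq_X_mul_le (hc : IsCompact μ.support) {R : ℝ}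
    (hR : μ.support ⊆ Metric.closedBall 0 R) (p : ℂ[X]) :
    polyNormSq μ (X * p) ≤ R ^ 2 * polyNormSq μ p := by
  rw [polyNormSq, polyNormSq, ← integral_const_mul]
  refine integral_mono_ae (integrable_normSq_eval hc _)
    ((integrable_normSq_eval hc p).const_mul _) ?_
  filter_upwards [Measure.support_mem_ae (μ := μ)] with z hz
  have : ‖z‖ ≤ R := by simpa using hR hz
  simp only [eval_mul, eval_X, norm_mul, mul_pow]
  gcongr

end FiniteMeasure

/-! ### Monic orthogonal polynomials -/

/-- Proved jointly: the first bound needs the degrees of the earlier `Φ_k`, and the degree of `Φ_n`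
needs the first bound. -/
theorem degree_sub_monicOP_lt_and (μ : Measure ℂ) (n : ℕ) :
    ((X ^ n : ℂ[X]) - monicOP μ n).degree < n ∧ (monicOP μ n).degree = n := by
  induction n using Nat.strong_induction_on with
  | _ n ih =>
    have h : ((X ^ n : ℂ[X]) - monicOP μ n).degree < n := by
      rw [monicOP, sub_sub_cancel]
      refine lt_of_le_of_lt (degree_sum_le _ _) ?_
      rw [Finset.sup_lt_iff (by exact_mod_cast WithBot.bot_lt_coe n)]
      intro k _
      rw [← smul_eq_C_mul]
      refine lt_of_le_of_lt (degree_smul_le _ _) ?_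
      rw [(ih k k.isLt).2]
      exact_mod_cast k.isLt
    refine ⟨h, ?_⟩
    have h2 : monicOP μ n = X ^ n - ((X ^ n : ℂ[X]) - monicOP μ n) := by ring
    rw [h2, degree_sub_eq_left_of_degree_lt (by rwa [degree_X_pow]), degree_X_pow]

theorem degree_monicOP (μ : Measure ℂ) (n : ℕ) : (monicOP μ n).degree = n :=
  (degree_sub_monicOP_lt_and μ n).2

theorem coeff_monicOP_self (μ : Measure ℂ) (n : ℕ) : (monicOP μ n).coeff n = 1 := by
  have h := coeff_eq_zero_of_degree_lt (degree_sub_monicOP_lt_and μ n).1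
  rw [coeff_sub, coeff_X_pow_self] at h
  exact (sub_eq_zero.1 h).symm

theorem monicOP_ne_zero (μ : Measure ℂ) (n : ℕ) : monicOP μ n ≠ 0 := by
  intro h
  simpa [h] using coeff_monicOP_self μ n

theorem monicOP_zero (μ : Measure ℂ) : monicOP μ 0 = 1 := by
  rw [monicOP]; simp

theorem degree_sub_C_mul_monicOP_lt (μ : Measure ℂ) {p : ℂ[X]} {n : ℕ} (hp : p.degree < (n + 1 : ℕ)) :
    (p - C (p.coeff n) * monicOP μ n).degree < n := by
  rw [degree_lt_iff_coeff_zero] at hp ⊢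
  intro m hm
  rcases hm.eq_or_lt with rfl | hm
  · simp [coeff_monicOP_self]
  · rw [coeff_sub, hp m hm, coeff_C_mul,
      coeff_eq_zero_of_degree_lt (p := monicOP μ n) (by rw [degree_monicOP]; exact_mod_cast hm)]
    simp

/-- The coefficient of `Φ_m` in the expansion of `p` in the monic orthogonal polynomials. -/
def opCoeff (μ : Measure ℂ) (m : ℕ) (p : ℂ[X]) : ℂ :=
  polyInner μ p (monicOP μ m) / polyInner μ (monicOP μ m) (monicOP μ m)

section Orthogonality

variable {μ : Measure ℂ} [IsFiniteMeasure μ]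

theorem polyInner_monicOP_self_ne_zero (hc : IsCompact μ.support) (hi : μ.support.Infinite) (n : ℕ) :
    polyInner μ (monicOP μ n) (monicOP μ n) ≠ 0 := by
  rw [polyInner_self]
  exact_mod_cast (polyNormSq_pos hc hi (monicOP_ne_zero μ n)).ne'

theorem polyInner_monicOP_of_lt (hc : IsCompact μ.support) (hi : μ.support.Infinite) {m n : ℕ}
    (hmn : m < n) : polyInner μ (monicOP μ n) (monicOP μ m) = 0 := by
  induction n using Nat.strong_induction_on generalizing m with
  | _ n ih =>
    rw [monicOP, polyInner_sub_left hc, polyInner_sum_left hc,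
      Finset.sum_eq_single (⟨m, hmn⟩ : Fin n)]
    · rw [polyInner_C_mul_left, div_mul_cancel₀ _ (polyInner_monicOP_self_ne_zero hc hi m), sub_self]
    · intro k _ hk
      have hk' : (k : ℕ) ≠ m := fun h => hk (Fin.ext h)
      rw [polyInner_C_mul_left]
      rcases lt_or_gt_of_ne hk' with h | h
      · rw [← conj_polyInner μ (monicOP μ m), ih m hmn h, map_zero, mul_zero]
      · rw [ih k k.isLt h, mul_zero]
    · simp

theorem polyInner_monicOP_of_ne (hc : IsCompact μ.support) (hi : μ.support.Infinite) {m n : ℕ}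
    (hmn : m ≠ n) : polyInner μ (monicOP μ n) (monicOP μ m) = 0 := by
  rcases lt_or_gt_of_ne hmn with h | h
  · exact polyInner_monicOP_of_lt hc hi h
  · rw [← conj_polyInner, polyInner_monicOP_of_lt hc hi h, map_zero]

theorem polyInner_monicOP_of_degree_lt (hc : IsCompact μ.support) (hi : μ.support.Infinite) {m n : ℕ}
    {p : ℂ[X]} (hp : p.degree < m) (hmn : m ≤ n) : polyInner μ p (monicOP μ n) = 0 := by
  induction m generalizing p with
  | zero =>
    have : p = 0 := by
      rw [← degree_eq_bot]; simpa [Nat.WithBot.lt_zero_iff] using hp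
    simp [this, polyInner]
  | succ m ih =>
    have h := ih (degree_sub_C_mul_monicOP_lt μ hp) (by omega)
    rwa [polyInner_sub_left hc, polyInner_C_mul_left, polyInner_monicOP_of_ne hc hi (by omega),
      mul_zero, sub_zero] at h

theorem opCoeff_add (hc : IsCompact μ.support) (m : ℕ) (p q : ℂ[X]) :
    opCoeff μ m (p + q) = opCoeff μ m p + opCoeff μ m q := by
  rw [opCoeff, polyInner_add_left hc, add_div]; rfl

theorem opCoeff_sum (hc : IsCompact μ.support) (m : ℕ) {ι : Type*} (s : Finset ι) (p : ι → ℂ[X]) :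
    opCoeff μ m (∑ i ∈ s, p i) = ∑ i ∈ s, opCoeff μ m (p i) := by
  rw [opCoeff, polyInner_sum_left hc, Finset.sum_div]; rfl

theorem opCoeff_C_mul (μ : Measure ℂ) (m : ℕ) (c : ℂ) (p : ℂ[X]) :
    opCoeff μ m (C c * p) = c * opCoeff μ m p := by
  rw [opCoeff, polyInner_C_mul_left, mul_div_assoc]; rfl

theorem opCoeff_eq_zero (hc : IsCompact μ.support) (hi : μ.support.Infinite) {m : ℕ} {p : ℂ[X]}
    (hp : p.degree < m) : opCoeff μ m p = 0 := by
  rw [opCoeff, polyInner_monicOP_of_degree_lt hc hi hp le_rfl, zero_div]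

theorem opCoeff_monicOP (hc : IsCompact μ.support) (hi : μ.support.Infinite) (m n : ℕ) :
    opCoeff μ m (monicOP μ n) = if m = n then 1 else 0 := by
  split_ifs with h
  · subst h; exact div_self (polyInner_monicOP_self_ne_zero hc hi m)
  · rw [opCoeff, polyInner_monicOP_of_ne hc hi h, zero_div]

/-- Because `Φ_m` is monic, the top orthogonal component can be read off as an ordinary coefficient.
This is why plain coefficients suffice for the truncated shift. -/
theorem opCoeff_eq_coeff (hc : IsCompact μ.support) (hi : μ.support.Infinite) {m : ℕ} {p : ℂ[X]}
    (hp : p.degree < (m + 1 : ℕ)) : opCoeff μ m p = p.coeff m := by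
  have h := opCoeff_add hc m (p - C (p.coeff m) * monicOP μ m) (C (p.coeff m) * monicOP μ m)
  rw [sub_add_cancel, opCoeff_eq_zero hc hi (degree_sub_C_mul_monicOP_lt μ hp), opCoeff_C_mul,
    opCoeff_monicOP hc hi, if_pos rfl, zero_add, mul_one] at h
  exact h

theorem eq_sum_opCoeff (hc : IsCompact μ.support) (hi : μ.support.Infinite) {n : ℕ} {p : ℂ[X]}
    (hp : p.degree < n) : p = ∑ m ∈ Finset.range n, C (opCoeff μ m p) * monicOP μ m := by
  induction n generalizing p with
  | zero =>
    rw [Finset.sum_range_zero, ← degree_eq_bot]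
    simpa [Nat.WithBot.lt_zero_iff] using hp
  | succ n ih =>
    have h := ih (degree_sub_C_mul_monicOP_lt μ hp)
    rw [Finset.sum_range_succ, opCoeff_eq_coeff hc hi hp]
    refine (sub_eq_iff_eq_add.1 h).trans ?_
    congr 1
    refine Finset.sum_congr rfl fun m hm => ?_
    have h2 := opCoeff_add hc m (p - C (p.coeff n) * monicOP μ n) (C (p.coeff n) * monicOP μ n)
    rw [sub_add_cancel, opCoeff_C_mul, opCoeff_monicOP hc hi,
      if_neg (Finset.mem_range.1 hm).ne, mul_zero, add_zero] at h2
    rw [h2]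

end Orthogonality

/-! ### The recurrence relation -/

/-- The coefficients of `z Φ_n = Φ_{n+1} + ∑_{i ≤ n} a_{n,i} Φ_{n-i}`. -/
def recCoeff (μ : Measure ℂ) (n i : ℕ) : ℂ :=
  if i ≤ n then opCoeff μ (n - i) (X * monicOP μ n) else 0

theorem polyNormSq_monicOP_mul_kappa_sq {μ : Measure ℂ} [IsFiniteMeasure μ]
    (hc : IsCompact μ.support) (hi : μ.support.Infinite) (n : ℕ) :
    polyNormSq μ (monicOP μ n) * kappa μ n ^ 2 = 1 := by
  have h := polyNormSq_pos hc hi (monicOP_ne_zero μ n)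
  have : kappa μ n = (Real.sqrt (polyNormSq μ (monicOP μ n)))⁻¹ := rfl
  rw [this, inv_pow, Real.sq_sqrt h.le, mul_inv_cancel₀ h.ne']

section Recurrence

variable {μ : Measure ℂ} [IsFiniteMeasure μ]

theorem degree_X_mul_monicOP_lt (μ : Measure ℂ) (n : ℕ) :
    (X * monicOP μ n : ℂ[X]).degree < (n + 1 + 1 : ℕ) := by
  rw [X_mul, degree_mul_X, degree_monicOP]
  exact_mod_cast Nat.lt_succ_self _

theorem X_mul_monicOP (hc : IsCompact μ.support) (hi : μ.support.Infinite) (n : ℕ) :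
    X * monicOP μ n = monicOP μ (n + 1) +
      ∑ i ∈ Finset.range (n + 1), C (recCoeff μ n i) * monicOP μ (n - i) := by
  have h := eq_sum_opCoeff hc hi (degree_X_mul_monicOP_lt μ n)
  rw [Finset.sum_range_succ, opCoeff_eq_coeff hc hi (degree_X_mul_monicOP_lt μ n), coeff_X_mul,
    coeff_monicOP_self, C_1, one_mul, add_comm, ← Finset.sum_range_reflect] at h
  refine h.trans (congrArg _ (Finset.sum_congr rfl fun i hi' => ?_))
  have hi'' : i ≤ n := Nat.lt_succ_iff.1 (Finset.mem_range.1 hi')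
  rw [recCoeff, if_pos hi'', show n + 1 - 1 - i = n - i by omega]

/-- The factors `κ_{m+j}` cancel, leaving `κ_m² ⟨z Φ_{m+j}, Φ_m⟩ = ⟨z Φ_{m+j}, Φ_m⟩ / ‖Φ_m‖²`. -/
theorem hasDiagonalLimit_iff (hc : IsCompact μ.support) (hi : μ.support.Infinite) (j : ℕ) (c : ℂ) :
    HasDiagonalLimit μ j c ↔ Tendsto (fun n => recCoeff μ n j) atTop (𝓝 c) := by
  rw [← tendsto_add_atTop_iff_nat j, HasDiagonalLimit]
  refine tendsto_congr fun m => ?_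
  have h0 : ((polyNormSq μ (monicOP μ m) : ℝ) : ℂ) * (kappa μ m : ℂ) ^ 2 = 1 := by
    exact_mod_cast polyNormSq_monicOP_mul_kappa_sq hc hi m
  have h1 : (kappa μ (m + j) : ℂ) ≠ 0 := by
    intro h
    have := polyNormSq_monicOP_mul_kappa_sq hc hi (m + j)
    rw [Complex.ofReal_eq_zero.1 h] at this
    simp at this
  have h2 : ((polyNormSq μ (monicOP μ m) : ℝ) : ℂ) ≠ 0 := left_ne_zero_of_mul_eq_one h0
  rw [recCoeff, if_pos (by omega), Nat.add_sub_cancel, opCoeff, polyInner_self, bergmanMatrix,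
    Matrix.of_apply, orthonormalPoly, orthonormalPoly, mul_left_comm, polyInner_C_mul_left,
    polyInner_C_mul_right, Complex.conj_ofReal, Complex.ofReal_div]
  field_simp
  linear_combination polyInner μ (X * monicOP μ (m + j)) (monicOP μ m) * h0

end Recurrence

/-! ### The truncated shift -/

/-- Multiplication by `z` followed by the removal of the `Φ_{n+1}`-component of a polynomial of
degree at most `n + 1`. -/
def truncShift (μ : Measure ℂ) (n : ℕ) : ℂ[X] →ₗ[ℂ] ℂ[X] where
  toFun p := X * p - C (p.coeff n) * monicOP μ (n + 1)
  map_add' p q := by simp only [coeff_add, C_add]; ring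
  map_smul' c p := by
    simp only [smul_eq_C_mul, coeff_C_mul, C_mul, RingHom.id_apply]; ring

theorem truncShift_apply (μ : Measure ℂ) (n : ℕ) (p : ℂ[X]) :
    truncShift μ n p = X * p - C (p.coeff n) * monicOP μ (n + 1) := rfl

theorem degree_truncShift_lt {μ : Measure ℂ} {n : ℕ} {p : ℂ[X]} (hp : p.degree < (n + 1 : ℕ)) :
    (truncShift μ n p).degree < (n + 1 : ℕ) := by
  have h : (X * p : ℂ[X]).degree < (n + 1 + 1 : ℕ) := by
    rw [degree_lt_iff_coeff_zero] at hp ⊢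
    intro m hm
    obtain ⟨m, rfl⟩ : ∃ k, m = k + 1 := ⟨m - 1, by omega⟩
    rw [coeff_X_mul]
    exact hp m (by omega)
  simpa only [truncShift_apply, coeff_X_mul] using degree_sub_C_mul_monicOP_lt μ h

theorem degree_truncShift_pow_lt {μ : Measure ℂ} {n : ℕ} {p : ℂ[X]} (hp : p.degree < (n + 1 : ℕ))
    (k : ℕ) : ((truncShift μ n ^ k) p).degree < (n + 1 : ℕ) := by
  induction k with
  | zero => simpa using hp
  | succ k ih => rw [pow_succ', Module.End.mul_apply]; exact degree_truncShift_lt ih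

theorem degree_monicOP_lt (μ : Measure ℂ) {m n : ℕ} (h : m < n) : (monicOP μ m).degree < n := by
  rw [degree_monicOP]; exact_mod_cast h

/-- The coefficients of the Laurent expansion `Φ_n / Φ_{n+1} = ∑_k b_k z^{-k-1}` at infinity. -/
def ratioCoeff (μ : Measure ℂ) (n k : ℕ) : ℂ :=
  ((truncShift μ n ^ k) (monicOP μ n)).coeff n

/-! ### Norm bounds and the Laurent expansion of the ratio -/

section Bounds

variable {μ : Measure ℂ} [IsFiniteMeasure μ]

/-- Pythagoras: `z p` is the orthogonal sum of its truncation and a multiple of `Φ_{n+1}`. -/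
theorem polyNormSq_truncShift_le (hc : IsCompact μ.support) (hi : μ.support.Infinite) {R : ℝ}
    (hR : μ.support ⊆ Metric.closedBall 0 R) {n : ℕ} {p : ℂ[X]} (hp : p.degree < (n + 1 : ℕ)) :
    polyNormSq μ (truncShift μ n p) ≤ R ^ 2 * polyNormSq μ p := by
  refine le_trans ?_ (polyNormSq_X_mul_le hc hR p)
  have h : polyInner μ (truncShift μ n p) (C (p.coeff n) * monicOP μ (n + 1)) = 0 := by
    rw [polyInner_C_mul_right,
      polyInner_monicOP_of_degree_lt hc hi (degree_truncShift_lt hp) le_rfl, mul_zero]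
  have h2 := polyNormSq_add_of_orthogonal hc h
  rw [truncShift_apply, sub_add_cancel] at h2
  rw [h2, truncShift_apply]
  exact le_add_of_nonneg_right (polyNormSq_nonneg μ _)

theorem polyNormSq_truncShift_pow_le (hc : IsCompact μ.support) (hi : μ.support.Infinite) {R : ℝ}
    (hR : μ.support ⊆ Metric.closedBall 0 R) {n : ℕ} {p : ℂ[X]} (hp : p.degree < (n + 1 : ℕ))
    (k : ℕ) : polyNormSq μ ((truncShift μ n ^ k) p) ≤ (R ^ k) ^ 2 * polyNormSq μ p := by
  induction k with
  | zero => simp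
  | succ k ih =>
    rw [pow_succ', Module.End.mul_apply]
    refine (polyNormSq_truncShift_le hc hi hR (degree_truncShift_pow_lt hp k)).trans ?_
    calc R ^ 2 * polyNormSq μ ((truncShift μ n ^ k) p)
        ≤ R ^ 2 * ((R ^ k) ^ 2 * polyNormSq μ p) := by gcongr
      _ = (R ^ (k + 1)) ^ 2 * polyNormSq μ p := by ring

theorem polyNormSq_eq_add (hc : IsCompact μ.support) (hi : μ.support.Infinite) {n : ℕ} {p : ℂ[X]}
    (hp : p.degree < (n + 1 : ℕ)) :
    polyNormSq μ p = polyNormSq μ (p - C (p.coeff n) * monicOP μ n) +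
      ‖p.coeff n‖ ^ 2 * polyNormSq μ (monicOP μ n) := by
  have h : polyInner μ (p - C (p.coeff n) * monicOP μ n) (C (p.coeff n) * monicOP μ n) = 0 := by
    rw [polyInner_C_mul_right,
      polyInner_monicOP_of_degree_lt hc hi (degree_sub_C_mul_monicOP_lt μ hp) le_rfl, mul_zero]
  rw [← polyNormSq_C_mul, ← polyNormSq_add_of_orthogonal hc h, sub_add_cancel]

theorem norm_ratioCoeff_le (hc : IsCompact μ.support) (hi : μ.support.Infinite) {R : ℝ} (hR0 : 0 ≤ R)
    (hR : μ.support ⊆ Metric.closedBall 0 R) (n k : ℕ) : ‖ratioCoeff μ n k‖ ≤ R ^ k := by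
  have hd := degree_monicOP_lt μ (Nat.lt_succ_self n)
  have h1 := polyNormSq_truncShift_pow_le hc hi hR hd k
  rw [polyNormSq_eq_add hc hi (degree_truncShift_pow_lt hd k)] at h1
  have h2 : ‖ratioCoeff μ n k‖ ^ 2 * polyNormSq μ (monicOP μ n) ≤
      (R ^ k) ^ 2 * polyNormSq μ (monicOP μ n) :=
    (le_add_of_nonneg_left (polyNormSq_nonneg μ _)).trans h1
  exact (pow_le_pow_iff_left₀ (norm_nonneg _) (by positivity) two_ne_zero).1
    (le_of_mul_le_mul_right h2 (polyNormSq_pos hc hi (monicOP_ne_zero μ n)))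

/-- Point evaluation is bounded on a finite-dimensional space. The constant may depend on `n` and
`z`, since it only serves to make the remainder of the Laurent expansion vanish for fixed `n` and
`z`. -/
theorem exists_norm_eval_le (hc : IsCompact μ.support) (hi : μ.support.Infinite) (n : ℕ) (z : ℂ) :
    ∃ K : ℝ, 0 ≤ K ∧ ∀ p : ℂ[X], p.degree < n → ‖p.eval z‖ ≤ K * Real.sqrt (polyNormSq μ p) := by
  induction n with
  | zero =>
    refine ⟨0, le_rfl, fun p hp => ?_⟩
    have : p = 0 := by
      rw [← degree_eq_bot]; simpa [Nat.WithBot.lt_zero_iff] using hp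
    simp [this]
  | succ n ih =>
    obtain ⟨K, hK, h⟩ := ih
    have hpos := polyNormSq_pos hc hi (monicOP_ne_zero μ n)
    refine ⟨K + ‖(monicOP μ n).eval z‖ / Real.sqrt (polyNormSq μ (monicOP μ n)), by positivity,
      fun p hp => ?_⟩
    have hN := polyNormSq_eq_add hc hi hp
    have h1 : Real.sqrt (polyNormSq μ (p - C (p.coeff n) * monicOP μ n)) ≤
        Real.sqrt (polyNormSq μ p) := by
      refine Real.sqrt_le_sqrt ?_
      rw [hN]
      exact le_add_of_nonneg_right (by positivity)
    have h2 : ‖p.coeff n‖ * Real.sqrt (polyNormSq μ (monicOP μ n)) ≤ Real.sqrt (polyNormSq μ p) := by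
      refine Real.le_sqrt_of_sq_le ?_
      rw [mul_pow, Real.sq_sqrt hpos.le, hN]
      exact le_add_of_nonneg_left (polyNormSq_nonneg μ _)
    have h3 : p.eval z =
        (p - C (p.coeff n) * monicOP μ n).eval z + p.coeff n * (monicOP μ n).eval z := by simp
    have hs := Real.sqrt_pos.2 hpos
    calc ‖p.eval z‖ ≤ ‖(p - C (p.coeff n) * monicOP μ n).eval z‖ +
          ‖p.coeff n‖ * ‖(monicOP μ n).eval z‖ := by
          rw [h3, ← norm_mul]; exact norm_add_le _ _
      _ ≤ K * Real.sqrt (polyNormSq μ p) +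
          ‖p.coeff n‖ * Real.sqrt (polyNormSq μ (monicOP μ n)) *
            (‖(monicOP μ n).eval z‖ / Real.sqrt (polyNormSq μ (monicOP μ n))) := by
          refine add_le_add ((h _ (degree_sub_C_mul_monicOP_lt μ hp)).trans ?_) (le_of_eq ?_)
          · gcongr
          · field_simp
      _ ≤ _ := by
          rw [add_mul, mul_comm (_ / _) (Real.sqrt _)]
          gcongr

/-- Iterates `p = z⁻¹ (T p + p_n Φ_{n+1})`, where `p_n` is the coefficient of `z^n`. -/
theorem eval_monicOP_eq (μ : Measure ℂ) (n : ℕ) {z : ℂ} (hz : z ≠ 0) (k : ℕ) :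
    (monicOP μ n).eval z =
      (monicOP μ (n + 1)).eval z * ∑ i ∈ Finset.range k, ratioCoeff μ n i * z⁻¹ ^ (i + 1) +
        z⁻¹ ^ k * ((truncShift μ n ^ k) (monicOP μ n)).eval z := by
  induction k with
  | zero => simp
  | succ k ih =>
    rw [ih, Finset.sum_range_succ, pow_succ' (truncShift μ n), Module.End.mul_apply,
      truncShift_apply, eval_sub, eval_mul, eval_mul, eval_X, eval_C, pow_succ (z⁻¹) k]
    change _ = _ + z⁻¹ ^ k * z⁻¹ * (_ - ratioCoeff μ n k * _)
    field_simp
    ring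

theorem hasSum_ratioCoeff (hc : IsCompact μ.support) (hi : μ.support.Infinite) {R : ℝ} (hR0 : 0 ≤ R)
    (hR : μ.support ⊆ Metric.closedBall 0 R) (n : ℕ) {z : ℂ} (hz : R < ‖z‖) :
    (monicOP μ (n + 1)).eval z ≠ 0 ∧
      HasSum (fun k => ratioCoeff μ n k * z⁻¹ ^ (k + 1))
        ((monicOP μ n).eval z / (monicOP μ (n + 1)).eval z) := by
  have hz1 : 0 < ‖z‖ := hR0.trans_lt hz
  have hz0 : z ≠ 0 := norm_pos_iff.1 hz1
  have hq : R / ‖z‖ < 1 := (div_lt_one hz1).2 hz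
  have hq0 : 0 ≤ R / ‖z‖ := by positivity
  have hsum : ∀ n, Summable fun k => ratioCoeff μ n k * z⁻¹ ^ (k + 1) := by
    intro n
    refine Summable.of_norm_bounded ((summable_geometric_of_lt_one hq0 hq).mul_right ‖z‖⁻¹)
      fun k => ?_
    rw [norm_mul, norm_pow, norm_inv, pow_succ, ← mul_assoc, div_pow, div_eq_mul_inv, ← inv_pow]
    gcongr
    exact norm_ratioCoeff_le hc hi hR0 hR n k
  -- Stated as a product, because `Φ_{n+1}(z) ≠ 0` is not yet known and is deduced from it.
  have key : ∀ n, (monicOP μ n).eval z =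
      (monicOP μ (n + 1)).eval z * ∑' k, ratioCoeff μ n k * z⁻¹ ^ (k + 1) := by
    intro n
    obtain ⟨K, hK, hev⟩ := exists_norm_eval_le hc hi (n + 1) z
    have hd := degree_monicOP_lt μ (Nat.lt_succ_self n)
    have h0 : Tendsto (fun k => z⁻¹ ^ k * ((truncShift μ n ^ k) (monicOP μ n)).eval z) atTop
        (𝓝 0) := by
      have hlim := (tendsto_pow_atTop_nhds_zero_of_lt_one hq0 hq).mul_const
        (K * Real.sqrt (polyNormSq μ (monicOP μ n)))
      rw [zero_mul] at hlim
      refine squeeze_zero_norm (fun k => ?_) hlim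
      have h1 : Real.sqrt (polyNormSq μ ((truncShift μ n ^ k) (monicOP μ n))) ≤
          R ^ k * Real.sqrt (polyNormSq μ (monicOP μ n)) := by
        rw [← Real.sqrt_sq (show 0 ≤ R ^ k by positivity), ← Real.sqrt_mul (by positivity)]
        exact Real.sqrt_le_sqrt (polyNormSq_truncShift_pow_le hc hi hR hd k)
      have h2 := hev _ (degree_truncShift_pow_lt (μ := μ) hd k)
      calc ‖z⁻¹ ^ k * ((truncShift μ n ^ k) (monicOP μ n)).eval z‖
          ≤ ‖z‖⁻¹ ^ k * (K * (R ^ k * Real.sqrt (polyNormSq μ (monicOP μ n)))) := by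
            rw [norm_mul, norm_pow, norm_inv]
            gcongr
            exact h2.trans (by gcongr)
        _ = (R / ‖z‖) ^ k * (K * Real.sqrt (polyNormSq μ (monicOP μ n))) := by
            rw [div_pow, inv_pow]; ring
    have h3 := ((hsum n).hasSum.tendsto_sum_nat.const_mul ((monicOP μ (n + 1)).eval z)).add h0
    rw [add_zero] at h3
    refine tendsto_nhds_unique (tendsto_const_nhds.congr fun k => ?_) h3
    exact eval_monicOP_eq μ n hz0 k
  -- By `key`, a zero of `Φ_{n+1}` at `z` would be a zero of `Φ_n`, and so on down to `Φ_0 = 1`.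
  have hne : ∀ n, (monicOP μ n).eval z ≠ 0 := by
    intro n
    induction n with
    | zero => simp [monicOP_zero]
    | succ n ih => exact fun h => ih (by rw [key n, h, zero_mul])
  refine ⟨hne _, ?_⟩
  convert (hsum n).hasSum using 1
  rw [key n, mul_div_cancel_left₀ _ (hne _)]

end Bounds

/-! ### Path sums of the recurrence coefficients -/

theorem sum_range_eq_sum_range {M : Type*} [AddCommMonoid M] {f : ℕ → M} {m n : ℕ}
    (hm : ∀ i, m ≤ i → f i = 0) (hn : ∀ i, n ≤ i → f i = 0) :
    ∑ i ∈ Finset.range m, f i = ∑ i ∈ Finset.range n, f i := by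
  have h : ∀ k ≤ max m n, (∀ i, k ≤ i → f i = 0) →
      ∑ i ∈ Finset.range k, f i = ∑ i ∈ Finset.range (max m n), f i := fun k hk h0 =>
    Finset.sum_subset (Finset.range_mono hk) fun i _ hi => h0 i (by simpa using hi)
  rw [h m (le_max_left _ _) hm, h n (le_max_right _ _) hn]

/-- The sum of the weights of the `k`-step paths from `n - t` to `n` that stay below `n + 1`, where
steps `m → m + 1` have weight `1` and steps `m → m - i` have weight `a m i`. -/
def truncPathSum (a : ℕ → ℕ → ℂ) : ℕ → ℕ → ℕ → ℂ
  | 0, t, _ => if t = 0 then 1 else 0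
  | k + 1, t, n => (if t = 0 then 0 else truncPathSum a k (t - 1) n) +
      ∑ i ∈ Finset.range (k + 1 - t), a (n - t) i * truncPathSum a k (t + i) n

/-- The sum of the weights of the `j`-step paths from `n` to `n + j - s`, where steps `m → m + 1`
have weight `1` and steps `m → m - i` have weight `a m i`. -/
def pathSum (a : ℕ → ℕ → ℂ) : ℕ → ℕ → ℕ → ℂ
  | 0, s, _ => if s = 0 then 1 else 0
  | j + 1, s, n => pathSum a j s (n + 1) +
      ∑ i ∈ Finset.range s, a n i * pathSum a j (s - i - 1) (n - i)

theorem truncPathSum_of_lt (a : ℕ → ℕ → ℂ) {k t : ℕ} (h : k < t) (n : ℕ) :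
    truncPathSum a k t n = 0 := by
  induction k generalizing t with
  | zero => rw [truncPathSum, if_neg (by omega)]
  | succ k ih =>
    rw [truncPathSum, if_neg (by omega), ih (by omega), show k + 1 - t = 0 by omega]
    simp

theorem truncPathSum_self (a : ℕ → ℕ → ℂ) (k n : ℕ) : truncPathSum a k k n = 1 := by
  induction k with
  | zero => simp [truncPathSum]
  | succ k ih => simp [truncPathSum, ih]

/-- From the top level the first step must drop. A drop by `k` leaves only the path that climbs
straight back, with weight `1`; this isolates `a n k`. -/
theorem truncPathSum_succ_zero (a : ℕ → ℕ → ℂ) (k n : ℕ) :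
    truncPathSum a (k + 1) 0 n =
      ∑ i ∈ Finset.range k, a n i * truncPathSum a k i n + a n k := by
  simp [truncPathSum, Finset.sum_range_succ, truncPathSum_self]

/-- A path climbs by at most one per step, so a drop too deep cannot be made up in the remaining
steps: only drops `l < L` occur when `k ≤ t + L`. -/
theorem tendsto_truncPathSum {a : ℕ → ℕ → ℂ} {c : ℕ → ℂ} {L : ℕ}
    (h : ∀ l < L, Tendsto (fun n => a n l) atTop (𝓝 (c l))) {k t : ℕ} (hk : k ≤ t + L) :
    Tendsto (fun n => truncPathSum a k t n) atTop (𝓝 (truncPathSum (fun _ => c) k t 0)) := by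
  induction k generalizing t with
  | zero => simp only [truncPathSum]; exact tendsto_const_nhds
  | succ k ih =>
    simp only [truncPathSum]
    refine Tendsto.add ?_ (tendsto_finsetSum _ fun i hi => ?_)
    · split_ifs with ht
      · exact tendsto_const_nhds
      · exact ih (by omega)
    · have hi := Finset.mem_range.1 hi
      exact ((h i (by omega)).comp (tendsto_sub_atTop_nat t)).mul (ih (by omega))

theorem tendsto_pathSum {a : ℕ → ℕ → ℂ} {c : ℕ → ℂ}
    (h : ∀ l, Tendsto (fun n => a n l) atTop (𝓝 (c l))) (j s : ℕ) :
    Tendsto (fun n => pathSum a j s n) atTop (𝓝 (pathSum (fun _ => c) j s 0)) := by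
  -- With translation-invariant weights the starting level is irrelevant, so every limit can be
  -- evaluated at level `0`.
  have hconst : ∀ j s m n, pathSum (fun _ => c) j s m = pathSum (fun _ => c) j s n := by
    intro j
    induction j with
    | zero => intro s m n; rfl
    | succ j ih =>
      intro s m n
      simp only [pathSum]
      rw [ih s (m + 1) (n + 1)]
      exact congrArg _ (Finset.sum_congr rfl fun i _ => by rw [ih _ (m - i) (n - i)])
  induction j generalizing s with
  | zero => simp only [pathSum]; exact tendsto_const_nhds
  | succ j ih =>
    simp only [pathSum]
    refine Tendsto.add ?_ (tendsto_finsetSum _ fun i _ => (h i).mul ?_)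
    · rw [hconst j s _ 0]
      exact (ih s).comp (tendsto_add_atTop_nat 1)
    · rw [hconst j _ _ 0]
      exact (ih _).comp (tendsto_sub_atTop_nat i)

/-- The limits of the sums over truncated paths determine the limits of the weights. -/
theorem exists_tendsto_of_tendsto_truncPathSum (b : ℕ → ℂ) :
    ∃ c : ℕ → ℂ, ∀ a : ℕ → ℕ → ℂ,
      (∀ k, Tendsto (fun n => truncPathSum a k 0 n) atTop (𝓝 (b k))) →
        ∀ j, Tendsto (fun n => a n j) atTop (𝓝 (c j)) := by
  have key : ∀ j, ∃ x : ℂ, ∀ a : ℕ → ℕ → ℂ,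
      (∀ k, Tendsto (fun n => truncPathSum a k 0 n) atTop (𝓝 (b k))) →
        Tendsto (fun n => a n j) atTop (𝓝 x) := by
    intro j
    induction j using Nat.strong_induction_on with
    | _ j ih =>
      choose! c hc using ih
      -- The limit of `truncPathSum_succ_zero`, solved for its last term.
      refine ⟨b (j + 1) - ∑ i ∈ Finset.range j, c i * truncPathSum (fun _ => c) j i 0,
        fun a ha => ?_⟩
      have hsum : Tendsto (fun n => ∑ i ∈ Finset.range j, a n i * truncPathSum a j i n) atTop
          (𝓝 (∑ i ∈ Finset.range j, c i * truncPathSum (fun _ => c) j i 0)) :=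
        tendsto_finsetSum _ fun i hi => (hc i (Finset.mem_range.1 hi) a ha).mul
          (tendsto_truncPathSum (L := j) (fun l hl => hc l hl a ha) (by omega))
      refine ((ha (j + 1)).sub hsum).congr fun n => ?_
      rw [truncPathSum_succ_zero, add_sub_cancel_left]
  choose c hc using key
  exact ⟨c, fun a ha j => hc j a ha⟩

/-! ### Orthogonal components as path sums -/

section

variable {μ : Measure ℂ} [IsFiniteMeasure μ]

theorem coeff_truncShift_pow (hc : IsCompact μ.support) (hi : μ.support.Infinite) {n t : ℕ}
    (ht : t ≤ n) (k : ℕ) :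
    ((truncShift μ n ^ k) (monicOP μ (n - t))).coeff n = truncPathSum (recCoeff μ) k t n := by
  induction k generalizing t with
  | zero =>
    rw [pow_zero, Module.End.one_apply, truncPathSum]
    split_ifs with h
    · rw [h, Nat.sub_zero, coeff_monicOP_self]
    · exact coeff_eq_zero_of_degree_lt (degree_monicOP_lt μ (by omega))
  | succ k ih =>
    have hT : truncShift μ n (monicOP μ (n - t)) =
        (if t = 0 then 0 else monicOP μ (n - (t - 1))) +
          ∑ i ∈ Finset.range (n - t + 1), recCoeff μ (n - t) i • monicOP μ (n - (t + i)) := by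
      rw [truncShift_apply, X_mul_monicOP hc hi]
      simp only [smul_eq_C_mul, ← Nat.sub_sub]
      split_ifs with h
      · subst h
        rw [Nat.sub_zero, coeff_monicOP_self, C_1]
        ring
      · rw [coeff_eq_zero_of_degree_lt (degree_monicOP_lt μ (by omega)),
          show n - t + 1 = n - (t - 1) by omega]
        simp
    rw [pow_succ, Module.End.mul_apply, hT, map_add, map_sum, coeff_add, finsetSum_coeff,
      truncPathSum]
    congr 1
    · split_ifs with h
      · simp
      · exact ih (by omega)
    · have h1 : ∀ i ∈ Finset.range (n - t + 1),
          ((truncShift μ n ^ k) (recCoeff μ (n - t) i • monicOP μ (n - (t + i)))).coeff n =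
            recCoeff μ (n - t) i * truncPathSum (recCoeff μ) k (t + i) n := by
        intro i hi'
        have := Finset.mem_range.1 hi'
        rw [map_smul, coeff_smul, smul_eq_mul, ih (by omega)]
      rw [Finset.sum_congr rfl h1]
      -- Beyond the first cutoff the weights vanish by the default value of `recCoeff`; beyond the
      -- second the path is too deep to return in `k` steps.
      refine sum_range_eq_sum_range (fun i hi' => ?_) (fun i hi' => ?_)
      · rw [recCoeff, if_neg (by omega), zero_mul]
      · rw [truncPathSum_of_lt _ (by omega), mul_zero]

theorem ratioCoeff_eq_truncPathSum (hc : IsCompact μ.support) (hi : μ.support.Infinite) (n k : ℕ) :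
    ratioCoeff μ n k = truncPathSum (recCoeff μ) k 0 n :=
  coeff_truncShift_pow hc hi (Nat.zero_le n) k

/-- Expanding the innermost factor `z Φ_n` by the recurrence is the first step of the path; `s` is
the shortfall from the highest reachable level `n + j`. -/
theorem opCoeff_X_pow_mul_monicOP (hc : IsCompact μ.support) (hi : μ.support.Infinite) {j s n : ℕ}
    (hs : s ≤ n + j) :
    opCoeff μ (n + j - s) (X ^ j * monicOP μ n) = pathSum (recCoeff μ) j s n := by
  induction j generalizing s n with
  | zero =>
    rw [pow_zero, one_mul, opCoeff_monicOP hc hi, pathSum]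
    congr 1
    simp only [eq_iff_iff]
    omega
  | succ j ih =>
    rw [pow_succ, mul_assoc, X_mul_monicOP hc hi, mul_add, Finset.mul_sum, opCoeff_add hc,
      opCoeff_sum hc, pathSum]
    congr 1
    · rw [← ih (by omega), show n + 1 + j = n + (j + 1) by omega]
    · simp only [mul_left_comm _ (C _), opCoeff_C_mul]
      rw [sum_range_eq_sum_range (n := s)]
      · refine Finset.sum_congr rfl fun i hi' => ?_
        have hi' := Finset.mem_range.1 hi'
        by_cases hin : i ≤ n
        · rw [← ih (by omega), show n + (j + 1) - s = n - i + j - (s - i - 1) by omega]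
        · rw [recCoeff, if_neg hin, zero_mul, zero_mul]
      · intro i hi'
        rw [recCoeff, if_neg (by omega), zero_mul]
      · intro i hi'
        rw [recCoeff]
        split_ifs with hin
        · rw [opCoeff_eq_zero hc hi (p := X ^ j * _), mul_zero]
          rw [degree_mul, degree_X_pow, degree_monicOP]
          exact_mod_cast (show j + (n - i) < n + (j + 1) - s by omega)
        · rw [zero_mul]

theorem moment_eq_pathSum (hc : IsCompact μ.support) (hi : μ.support.Infinite) (j n : ℕ) :
    moment μ j n = pathSum (recCoeff μ) j j n := by
  rw [← opCoeff_X_pow_mul_monicOP hc hi (Nat.le_add_left j n), Nat.add_sub_cancel]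
  have h0 : ((polyNormSq μ (monicOP μ n) : ℝ) : ℂ) * (kappa μ n : ℂ) ^ 2 = 1 := by
    exact_mod_cast polyNormSq_monicOP_mul_kappa_sq hc hi n
  have h1 : ((polyNormSq μ (monicOP μ n) : ℝ) : ℂ) ≠ 0 := left_ne_zero_of_mul_eq_one h0
  have h2 : moment μ j n = polyInner μ (X ^ j * orthonormalPoly μ n) (orthonormalPoly μ n) := by
    refine integral_congr_ae (Eventually.of_forall fun z => ?_)
    simp only [eval_mul, eval_pow, eval_X, mul_assoc, Complex.mul_conj', Complex.ofReal_pow]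
  rw [h2, opCoeff, polyInner_self, orthonormalPoly, mul_left_comm, polyInner_C_mul_left,
    polyInner_C_mul_right, Complex.conj_ofReal, eq_div_iff h1]
  linear_combination polyInner μ (X ^ j * monicOP μ n) (monicOP μ n) * h0

end

/-! ### Convergence of the Laurent coefficients -/

/-- The linear bound at `0` has a constant depending only on `K`, `R`, `ρ`, hence uniform over a
family of series. -/
theorem norm_tsum_sub_coeff_zero_le {d : ℕ → ℂ} {K R ρ : ℝ} (hR : 0 ≤ R) (hRρ : R * ρ < 1)
    (hd : ∀ k, ‖d k‖ ≤ K * R ^ k) {w : ℂ} (hw : ‖w‖ < ρ) :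
    Summable (fun k => d k * w ^ k) ∧
      ‖∑' k, d k * w ^ k - d 0‖ ≤ K * R * (1 - R * ρ)⁻¹ * ‖w‖ := by
  have hρ : 0 ≤ ρ := (norm_nonneg w).trans hw.le
  have hK : 0 ≤ K := by simpa using (norm_nonneg _).trans (hd 0)
  have hgeo := hasSum_geometric_of_lt_one (mul_nonneg hR hρ) hRρ
  have hb : ∀ k, ‖d k * w ^ k‖ ≤ K * (R * ρ) ^ k := fun k => by
    rw [norm_mul, norm_pow, mul_pow, ← mul_assoc]
    gcongr
    exact hd k
  have hs : Summable fun k => d k * w ^ k := .of_norm_bounded (hgeo.summable.mul_left K) hb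
  refine ⟨hs, ?_⟩
  rw [hs.tsum_eq_zero_add, pow_zero, mul_one, add_sub_cancel_left]
  refine tsum_of_norm_bounded ((hgeo.mul_left (K * R)).mul_right ‖w‖) fun k => ?_
  calc ‖d (k + 1) * w ^ (k + 1)‖ ≤ K * R ^ (k + 1) * (ρ ^ k * ‖w‖) := by
        rw [norm_mul, norm_pow, pow_succ ‖w‖]
        gcongr
        exact hd _
    _ = K * R * (R * ρ) ^ k * ‖w‖ := by ring

/-- If power series with a common geometric bound on the coefficients tend to `0` pointwise in a
punctured disk, then their coefficients tend to `0`. -/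
theorem tendsto_coeff_zero_of_tendsto_tsum {ι : Type*} {l : Filter ι} {D : ι → ℕ → ℂ} {K R ρ : ℝ}
    (hR : 0 ≤ R) (hρ : 0 < ρ) (hRρ : R * ρ < 1) (hD : ∀ i k, ‖D i k‖ ≤ K * R ^ k)
    (h : ∀ w : ℂ, w ≠ 0 → ‖w‖ < ρ → Tendsto (fun i => ∑' k, D i k * w ^ k) l (𝓝 0)) (k : ℕ) :
    Tendsto (fun i => D i k) l (𝓝 0) := by
  rcases isEmpty_or_nonempty ι with hι | ⟨⟨i₀⟩⟩
  · simp [Filter.filter_eq_bot_of_isEmpty l]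
  have h0 : ∀ {D : ι → ℕ → ℂ} {K : ℝ}, (∀ i k, ‖D i k‖ ≤ K * R ^ k) →
      (∀ w : ℂ, w ≠ 0 → ‖w‖ < ρ → Tendsto (fun i => ∑' k, D i k * w ^ k) l (𝓝 0)) →
      Tendsto (fun i => D i 0) l (𝓝 0) := by
    intro D K hD h
    have hK : 0 ≤ K := by simpa using (norm_nonneg _).trans (hD i₀ 0)
    set B := K * R * (1 - R * ρ)⁻¹
    have hB : 0 ≤ B := mul_nonneg (mul_nonneg hK hR) (inv_nonneg.2 (by linarith))
    rw [Metric.tendsto_nhds]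
    intro ε hε
    -- A test point so close to `0` that the series there differs from its constant term by at most
    -- `ε / 2`; `B + 1` avoids division by zero.
    set x : ℝ := min (ρ / 2) (ε / (2 * (B + 1)))
    have hx : 0 < x := lt_min (by linarith) (by positivity)
    have hnorm : ‖(x : ℂ)‖ = x := by simp [abs_of_pos hx]
    have hxρ : ‖(x : ℂ)‖ < ρ := by
      rw [hnorm]; exact (min_le_left _ _).trans_lt (by linarith)
    have hBx : B * x ≤ ε / 2 := by
      calc B * x ≤ (B + 1) * (ε / (2 * (B + 1))) := by
            gcongr
            · linarith
            · exact min_le_right _ _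
        _ = ε / 2 := by field_simp
    have hev := Metric.tendsto_nhds.1 (h x (by exact_mod_cast hx.ne') hxρ) (ε / 2) (by linarith)
    filter_upwards [hev] with i hi
    rw [dist_zero_right] at hi ⊢
    have h1 := (norm_tsum_sub_coeff_zero_le hR hRρ (hD i) hxρ).2
    rw [hnorm] at h1
    have h2 := norm_sub_le (∑' k, D i k * (x : ℂ) ^ k) (∑' k, D i k * (x : ℂ) ^ k - D i 0)
    rw [sub_sub_cancel] at h2
    linarith
  induction k generalizing D K with
  | zero => exact h0 hD h
  | succ k ih =>
    -- Subtract the constant terms, which tend to `0`, and divide by `w ≠ 0`: the shifted series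
    -- satisfy the same hypotheses.
    refine ih (D := fun i k => D i (k + 1)) (K := K * R) (fun i k => ?_) fun w hw0 hw => ?_
    · exact (hD i (k + 1)).trans (le_of_eq (by ring))
    · have h1 := ((h w hw0 hw).sub (h0 hD h)).mul_const w⁻¹
      rw [sub_zero, zero_mul] at h1
      refine h1.congr fun i => ?_
      rw [(norm_tsum_sub_coeff_zero_le hR hRρ (hD i) hw).1.tsum_eq_zero_add, pow_zero, mul_one,
        add_sub_cancel_left, ← tsum_mul_right]
      refine tsum_congr fun k => ?_
      rw [pow_succ]
      field_simp

theorem exists_support_subset_closedBall {μ : Measure ℂ} (hc : IsCompact μ.support) :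
    ∃ R : ℝ, 1 ≤ R ∧ μ.support ⊆ Metric.closedBall 0 R := by
  obtain ⟨R, hR⟩ := hc.isBounded.subset_closedBall 0
  exact ⟨max 1 R, le_max_left _ _, hR.trans (Metric.closedBall_subset_closedBall (le_max_right _ _))⟩

/-- A limit of `Φ_n / Φ_{n+1}` that is analytic at infinity determines the limits of the Laurent
coefficients of `Φ_n / Φ_{n+1}`. -/
theorem exists_tendsto_ratioCoeff {R : ℝ} {f : OnePoint ℂ → ℂ} (hf : AnalyticOutside R f) :
    ∃ b : ℕ → ℂ, ∀ (μ : Measure ℂ) [IsFiniteMeasure μ], IsCompact μ.support → μ.support.Infinite →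
      HasRatioLimit μ R f → ∀ k, Tendsto (fun n => ratioCoeff μ n k) atTop (𝓝 (b k)) := by
  obtain ⟨p, hp⟩ := hf.2
  -- In `w = 1 / z` the ratio is `∑ b_k w^{k+1}`, hence the shift. The sequence is fixed before `μ`,
  -- as it depends on `f` alone.
  refine ⟨fun k => p.coeff (k + 1), fun μ _ hc hi hlim k => ?_⟩
  obtain ⟨R₀, hR₀, hsupp⟩ := exists_support_subset_closedBall hc
  obtain ⟨K, r, hK, hr, hpr⟩ := p.le_mul_pow_of_radius_pos hp.radius_pos
  obtain ⟨δ, hδ, hsum⟩ := Metric.eventually_nhds_iff.1 (hasFPowerSeriesAt_iff.1 hp)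
  -- Dominates the growth of both coefficient sequences and keeps `1 / w` in the domain of
  -- convergence.
  set S : ℝ := max (max R₀ r) R + 1
  have hSR₀ : R₀ < S := by
    have := (le_max_left R₀ r).trans (le_max_left _ R); linarith [this]
  have hSr : r < S := by
    have := (le_max_right R₀ r).trans (le_max_left _ R); linarith [this]
  have hSR : R < S := by
    have := le_max_right (max R₀ r) R; linarith [this]
  have hS : 0 < S := by linarith
  let s : ℕ → ℕ → ℂ := fun n k => Nat.casesOn k 0 (ratioCoeff μ n)
  have hs : ∀ n k, ‖s n k‖ ≤ S ^ k := by
    intro n k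
    cases k with
    | zero => simp [s]
    | succ k =>
      calc ‖ratioCoeff μ n k‖ ≤ R₀ ^ k := norm_ratioCoeff_le hc hi (by linarith) hsupp n k
        _ ≤ S ^ k := by gcongr
        _ ≤ S ^ (k + 1) := pow_le_pow_right₀ (by linarith) (Nat.le_succ k)
  have hD : ∀ n k, ‖s n k - p.coeff k‖ ≤ (1 + K) * S ^ k := by
    intro n k
    refine (norm_sub_le _ _).trans ?_
    rw [add_mul, one_mul, ← FormalMultilinearSeries.norm_apply_eq_norm_coef]
    refine add_le_add (hs n k) ((hpr k).trans ?_)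
    gcongr
  set ρ : ℝ := min δ (S + 1)⁻¹
  have hρ : 0 < ρ := lt_min hδ (by positivity)
  have hSρ : S * ρ < 1 := by
    calc S * ρ ≤ S * (S + 1)⁻¹ := by gcongr; exact min_le_right _ _
      _ < 1 := by rw [← div_eq_mul_inv, div_lt_one (by linarith)]; linarith
  have key := tendsto_coeff_zero_of_tendsto_tsum (l := atTop) hS.le hρ hSρ hD (fun w hw0 hw => ?_)
    (k + 1)
  · have := key.add_const (p.coeff (k + 1))
    simpa [s] using this
  · have hwinv : S < ‖w⁻¹‖ := by
      rw [norm_inv, lt_inv_comm₀ hS (norm_pos_iff.2 hw0)]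
      have := hw.trans_le (min_le_right δ _)
      refine this.trans (inv_strictAnti₀ hS (by linarith))
    have h1 : HasSum (fun k => p.coeff k * w ^ k) (f (OnePoint.some w⁻¹)) := by
      have := hsum (y := w) (by rw [dist_zero_right]; exact hw.trans_le (min_le_left _ _))
      simpa [sphereInv, hw0, mul_comm] using this
    have h2 : ∀ n, HasSum (fun k => s n k * w ^ k)
        ((monicOP μ n).eval w⁻¹ / (monicOP μ (n + 1)).eval w⁻¹) := by
      intro n
      have := (hasSum_ratioCoeff hc hi (by linarith) hsupp n (hSR₀.trans hwinv)).2
      rw [inv_inv] at this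
      refine (hasSum_nat_add_iff' 1).1 ?_
      change HasSum (fun k => ratioCoeff μ n k * w ^ (k + 1)) (_ - _)
      simpa [s] using this
    have h3 := ((hlim.2.1 w⁻¹ (hSR.trans hwinv)).2).sub_const (f (OnePoint.some w⁻¹))
    rw [sub_self] at h3
    refine h3.congr fun n => ?_
    refine ((h2 n).sub h1).tsum_eq.symm.trans ?_
    exact tsum_congr fun k => (sub_mul _ _ _).symm

/-- The quantifier order matters: `c` is chosen from `f` before the measure, so two measures with
the same `f` share it. -/
theorem exists_hasDiagonalLimit_of_analyticOutside {R : ℝ} {f : OnePoint ℂ → ℂ}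
    (hf : AnalyticOutside R f) :
    ∃ c : ℕ → ℂ, ∀ (μ : Measure ℂ) [IsFiniteMeasure μ], IsCompact μ.support → μ.support.Infinite →
      HasRatioLimit μ R f → ∀ j, HasDiagonalLimit μ j (c j) := by
  obtain ⟨b, hb⟩ := exists_tendsto_ratioCoeff hf
  obtain ⟨c, hc'⟩ := exists_tendsto_of_tendsto_truncPathSum b
  refine ⟨c, fun μ _ hc hi hlim j => (hasDiagonalLimit_iff hc hi j _).2 (hc' _ (fun k => ?_) j)⟩
  simpa only [ratioCoeff_eq_truncPathSum hc hi] using hb μ hc hi hlim k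

/-! ### From diagonal limits to ratio limits and moments -/

section

variable {μ : Measure ℂ} [IsFiniteMeasure μ]

/-- The limiting coefficients inherit the bound `R₀ ^ k`, so their series is analytic near infinity,
and dominated convergence passes to the limit termwise. -/
theorem exists_hasRatioLimit (hc : IsCompact μ.support) (hi : μ.support.Infinite)
    {c : ℕ → ℂ} (h : ∀ j, HasDiagonalLimit μ j (c j)) :
    ∃ R : ℝ, 0 < R ∧ ∃ f : OnePoint ℂ → ℂ, HasRatioLimit μ R f := by
  have ha := fun j => (hasDiagonalLimit_iff hc hi j _).1 (h j)
  obtain ⟨R₀, hR₀, hsupp⟩ := exists_support_subset_closedBall hc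
  set b : ℕ → ℂ := fun k => truncPathSum (fun _ => c) k 0 0
  have hb : ∀ k, Tendsto (fun n => ratioCoeff μ n k) atTop (𝓝 (b k)) := by
    intro k
    simp only [ratioCoeff_eq_truncPathSum hc hi]
    exact tendsto_truncPathSum (L := k) (fun l _ => ha l) (by omega)
  have hbound : ∀ n k, ‖ratioCoeff μ n k‖ ≤ R₀ ^ k :=
    norm_ratioCoeff_le hc hi (by linarith) hsupp
  have hbR : ∀ k, ‖b k‖ ≤ R₀ ^ k := fun k =>
    le_of_tendsto (hb k).norm (Eventually.of_forall fun n => hbound n k)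
  set S : ℝ := R₀ + 1
  have hS : 0 < S := by positivity
  have hu : Summable fun k : ℕ => (R₀ / S) ^ k * S⁻¹ :=
    (summable_geometric_of_lt_one (by positivity)
      ((div_lt_one hS).2 (lt_add_one R₀))).mul_right _
  have hterm : ∀ (x w : ℂ) (k : ℕ), ‖x‖ ≤ R₀ ^ k → ‖w‖ ≤ S⁻¹ →
      ‖x * w ^ (k + 1)‖ ≤ (R₀ / S) ^ k * S⁻¹ := by
    intro x w k hx hw
    rw [norm_mul, norm_pow, pow_succ, ← mul_assoc, div_pow, div_eq_mul_inv, ← inv_pow]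
    gcongr
  set g : ℂ → ℂ := fun w => ∑' k, b k * w ^ (k + 1)
  have hg : AnalyticOnNhd ℂ g (Metric.ball 0 S⁻¹) := by
    refine DifferentiableOn.analyticOnNhd ?_ Metric.isOpen_ball
    refine Complex.differentiableOn_tsum_of_summable_norm hu (fun k => ?_) Metric.isOpen_ball
      fun k w hw => hterm _ w k (hbR k) ?_
    · exact ((differentiable_id.pow (k + 1)).const_mul (b k)).differentiableOn
    · simpa using (mem_ball_zero_iff.1 hw).le
  have hinv : ∀ z : ℂ, S < ‖z‖ → ‖z⁻¹‖ < S⁻¹ := fun z hz => by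
    rw [norm_inv]; exact inv_strictAnti₀ hS hz
  let f : OnePoint ℂ → ℂ := fun
    | OnePoint.infty => 0
    | OnePoint.some z => g z⁻¹
  refine ⟨S, hS, f, ⟨?_, ?_⟩, ?_, ?_⟩
  · intro z hz
    have hz' : S < ‖z‖ := hz
    have hz0 : z ≠ 0 := norm_pos_iff.1 (hS.trans hz')
    have hcomp : AnalyticAt ℂ (fun z : ℂ => g z⁻¹) z :=
      (hg z⁻¹ (by simpa using hinv z hz')).fun_comp (analyticAt_inv hz0)
    exact hcomp
  · have h0 : (fun w : ℂ => f (sphereInv w)) = g := by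
      funext w
      by_cases hw : w = 0
      · simp only [sphereInv, if_pos hw]
        simp [g, hw, f]
      · simp only [sphereInv, if_neg hw]
        change g (w⁻¹)⁻¹ = g w
        rw [inv_inv]
    rw [h0]
    exact hg 0 (by simpa using hS)
  · intro z hz
    have hsum := fun n => hasSum_ratioCoeff hc hi (by linarith) hsupp n ((lt_add_one R₀).trans hz)
    refine ⟨Eventually.of_forall fun n => (hsum n).1, ?_⟩
    have h1 : Tendsto (fun n => ∑' k, ratioCoeff μ n k * z⁻¹ ^ (k + 1)) atTop (𝓝 (g z⁻¹)) :=
      tendsto_tsum_of_dominated_convergence hu (fun k => (hb k).mul_const _)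
        (Eventually.of_forall fun n k => hterm _ _ k (hbound n k) (hinv z hz).le)
    exact h1.congr fun n => (hsum n).2.tsum_eq
  · refine tendsto_const_nhds.congr fun n => ?_
    change (0 : ℂ) = (monicOP μ n).coeff (monicOP μ (n + 1)).natDegree / _
    rw [natDegree_eq_of_degree_eq_some (degree_monicOP μ (n + 1)),
      coeff_eq_zero_of_degree_lt (degree_monicOP_lt μ (Nat.lt_succ_self n)), zero_div]

theorem tendsto_moment (hc : IsCompact μ.support) (hi : μ.support.Infinite) {c : ℕ → ℂ}
    (h : ∀ j, HasDiagonalLimit μ j (c j)) (j : ℕ) :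
    Tendsto (fun n => moment μ j n) atTop (𝓝 (pathSum (fun _ => c) j j 0)) := by
  simp only [moment_eq_pathSum hc hi]
  exact tendsto_pathSum (fun l => (hasDiagonalLimit_iff hc hi l _).1 (h l)) j j

end

end BergmanShift

end

theorem theorem1p2 (μ : MeasureTheory.Measure ℂ) [MeasureTheory.IsFiniteMeasure μ]
    (hcompact : IsCompact μ.support) (hinfinite : μ.support.Infinite) :
    ((∃ R : ℝ, 0 < R ∧ ∃ f : OnePoint ℂ → ℂ, BergmanShift.HasRatioLimit μ R f) ↔
      (∀ j : ℕ, ∃ c : ℂ, BergmanShift.HasDiagonalLimit μ j c)) ∧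
    (((∃ R : ℝ, 0 < R ∧ ∃ f : OnePoint ℂ → ℂ, BergmanShift.HasRatioLimit μ R f) ∨
      (∀ j : ℕ, ∃ c : ℂ, BergmanShift.HasDiagonalLimit μ j c)) →
      ∀ j : ℕ, ∃ L : ℂ,
        Tendsto (fun n => BergmanShift.moment μ j n) atTop (𝓝 L) ∧
        ∀ (ν : MeasureTheory.Measure ℂ) [MeasureTheory.IsFiniteMeasure ν],
          IsCompact ν.support → ν.support.Infinite →
          ((∃ R : ℝ, 0 < R ∧ ∃ f : OnePoint ℂ → ℂ,
              BergmanShift.HasRatioLimit μ R f ∧ BergmanShift.HasRatioLimit ν R f) ∨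
            (∀ i : ℕ, ∃ c : ℂ,
              BergmanShift.HasDiagonalLimit μ i c ∧ BergmanShift.HasDiagonalLimit ν i c)) →
          Tendsto (fun n => BergmanShift.moment ν j n) atTop (𝓝 L)) := by
  have hab : (∃ R : ℝ, 0 < R ∧ ∃ f : OnePoint ℂ → ℂ, BergmanShift.HasRatioLimit μ R f) →
      ∀ j : ℕ, ∃ c : ℂ, BergmanShift.HasDiagonalLimit μ j c := by
    rintro ⟨R, -, f, hf⟩ j
    obtain ⟨c, hc⟩ := BergmanShift.exists_hasDiagonalLimit_of_analyticOutside hf.1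
    exact ⟨c j, hc μ hcompact hinfinite hf j⟩
  refine ⟨⟨hab, fun h => ?_⟩, fun h j => ?_⟩
  · choose c hc using h
    exact BergmanShift.exists_hasRatioLimit hcompact hinfinite hc
  · choose c hc using h.elim hab id
    refine ⟨_, BergmanShift.tendsto_moment hcompact hinfinite hc j, fun ν _ hν hν' h => ?_⟩
    refine BergmanShift.tendsto_moment hν hν' (c := c) (fun i => ?_) j
    rcases h with ⟨R, -, f, hfμ, hfν⟩ | h
    · obtain ⟨c', hc'⟩ := BergmanShift.exists_hasDiagonalLimit_of_analyticOutside hfμ.1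
      -- Uniqueness of limits for `μ` identifies `c i` with the value determined by `f`, which `ν`
      -- shares.
      rw [tendsto_nhds_unique (hc i) (hc' μ hcompact hinfinite hfμ i)]
      exact hc' ν hν hν' hfν i
    · obtain ⟨x, hx, hx'⟩ := h i
      rwa [tendsto_nhds_unique (hc i) hx]
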